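/- All strings are binary. A parameterized problem is a pair $(X,\kappa)$ with $X\subseteq\{0,1\}^*$ and $\kappa:\{0,1\}^*\to\mathbb{N}$ computable in polynomial time. A polynomial Turing kernelization for $(X,\kappa)$ is a deterministic oracle Turing machine that runs in time polynomial in $|x|$ on every input $x$ (with any oracle), that decides $X$ when its oracle is $X$, and for which there is a polynomial $f$ such that, with oracle $X$, every oracle query made on input $x$ has length at most $f(\kappa(x))$. It is a polynomial truth-table kernelization if, on every input, the sequence of queries is independent of the oracle's answers. A polynomial truth-table kernelization is a psize kernelization if there are polynomials $q,r$ such that on every input $x$ it makes at most $q(\kappa(x))$ oracle queries, and there is a Boolean circuit with at most $r(\kappa(x))$ gates that, given the oracle's answers to these queries, outputs the machine's output on $x$, for every oracle. **Theorem.** There is a parameterized problem that has a polynomial truth-table kernelization but no psize kernelization. -/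

import Mathlib

namespace Kernelization

/-- A parameterized problem `(X, κ)`: a set `X` of binary strings together with a parameterization,
that is, a polynomial-time computable function `κ` from binary strings to natural numbers
(with values written in binary). -/
structure ParameterizedProblem where
  /-- the set of yes-instances -/
  lang : Set (List Bool)
  /-- the parameterization -/
  param : List Bool → ℕ
  /-- the parameterization is computable in polynomial time -/
  param_polytime :
    Nonempty (Turing.TM2ComputableInPolyTime (id : List Bool → List Bool)
      Computability.encodeNat param)

/-- A deterministic oracle Turing machine that accepts or rejects its input: a multi-stack machine
in Mathlib's `TM2` model (finitely many stacks over the binary alphabet, finitely many labels and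
internal states), with a designated query stack and designated query, yes and no labels. -/
structure OracleTM where
  /-- number of stacks -/
  numStacks : ℕ
  /-- number of labels -/
  numLabels : ℕ
  /-- number of internal states -/
  numStates : ℕ
  /-- the stack that initially holds the input -/
  inputStack : Fin numStacks
  /-- the stack on which oracle queries are written -/
  queryStack : Fin numStacks
  /-- the initial label -/
  main : Fin numLabels
  /-- the label at which the oracle is consulted -/
  queryLabel : Fin numLabels
  /-- the label at which the machine continues after a positive answer of the oracle -/
  yesLabel : Fin numLabels
  /-- the label at which the machine continues after a negative answer of the oracle -/
  noLabel : Fin numLabels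
  /-- the initial internal state -/
  initialState : Fin numStates
  /-- the internal states in which halting means acceptance -/
  accept : Fin numStates → Bool
  /-- the program (its statement at `queryLabel` is never executed) -/
  program : Fin numLabels →
    Turing.TM2.Stmt (fun _ : Fin numStacks => Bool) (Fin numLabels) (Fin numStates)

namespace OracleTM

/-- Configurations: current label (`none` when halted), internal state, contents of the stacks. -/
abbrev Cfg (M : OracleTM) : Type :=
  Turing.TM2.Cfg (fun _ : Fin M.numStacks => Bool) (Fin M.numLabels) (Fin M.numStates)

/-- The initial configuration on input `x`: the first symbol of `x` is on top of the input stack,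
and all other stacks are empty. -/
def init (M : OracleTM) (x : List Bool) : M.Cfg where
  l := some M.main
  var := M.initialState
  stk := Function.update (fun _ => []) M.inputStack x

open Classical in
/-- The configuration after consulting the oracle `O` in configuration `c`. The queried string is
the content of the query stack (read from the top), which is erased. -/
noncomputable def afterQuery (M : OracleTM) (O : Set (List Bool)) (c : M.Cfg) : M.Cfg where
  l := some (if c.stk M.queryStack ∈ O then M.yesLabel else M.noLabel)
  var := c.var
  stk := Function.update c.stk M.queryStack []

/-- `M.RunFrom O c t qs b`: started in configuration `c` with oracle `O`, the machine halts after
exactly `t` steps, the oracle queries that it makes are the strings in the list `qs` (in this order,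
with repetitions), and `b` tells whether it accepts. Consulting the oracle takes one step. -/
inductive RunFrom (M : OracleTM) (O : Set (List Bool)) :
    M.Cfg → ℕ → List (List Bool) → Bool → Prop
  | halt {c : M.Cfg} : c.l = none → RunFrom M O c 0 [] (M.accept c.var)
  | query {c : M.Cfg} {t : ℕ} {qs : List (List Bool)} {b : Bool} :
      c.l = some M.queryLabel → RunFrom M O (M.afterQuery O c) t qs b →
      RunFrom M O c (t + 1) (c.stk M.queryStack :: qs) b
  | step {c c' : M.Cfg} {t : ℕ} {qs : List (List Bool)} {b : Bool} :
      c.l ≠ some M.queryLabel → Turing.TM2.step M.program c = some c' →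
      RunFrom M O c' t qs b → RunFrom M O c (t + 1) qs b

/-- `M.Run O x t qs b`: on input `x` and with oracle `O`, the machine halts after exactly `t` steps
with answer `b`, having made precisely the queries `qs`. -/
def Run (M : OracleTM) (O : Set (List Bool)) (x : List Bool) (t : ℕ) (qs : List (List Bool))
    (b : Bool) : Prop :=
  M.RunFrom O (M.init x) t qs b

/-- A polynomial-time oracle machine: the running time is bounded by a polynomial in the length of
the input, whatever the oracle. -/
def PolyTime (M : OracleTM) : Prop :=
  ∃ p : Polynomial ℕ, ∀ (O : Set (List Bool)) (x : List Bool),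
    ∃ (t : ℕ) (qs : List (List Bool)) (b : Bool), M.Run O x t qs b ∧ t ≤ p.eval x.length

/-- A polynomial Turing kernelization for `(X, κ)`: a polynomial-time oracle machine that, with
oracle `X`, decides `X`, and whose queries on an input `x` have length polynomial in `κ(x)`. -/
structure IsPolyTuringKernelization (M : OracleTM) (P : ParameterizedProblem) : Prop where
  polyTime : M.PolyTime
  decides : ∀ (x : List Bool) (t : ℕ) (qs : List (List Bool)) (b : Bool),
    M.Run P.lang x t qs b → (b = true ↔ x ∈ P.lang)
  query_size : ∃ f : Polynomial ℕ, ∀ (x : List Bool) (t : ℕ) (qs : List (List Bool)) (b : Bool),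
    M.Run P.lang x t qs b → ∀ q ∈ qs, q.length ≤ f.eval (P.param x)

/-- Non-adaptivity: on every input, the queries are independent of the oracle's answers. -/
def NonAdaptive (M : OracleTM) : Prop :=
  ∀ (x : List Bool) (O O' : Set (List Bool)) (t t' : ℕ) (qs qs' : List (List Bool)) (b b' : Bool),
    M.Run O x t qs b → M.Run O' x t' qs' b' → qs = qs'

/-- A polynomial truth-table kernelization: a non-adaptive polynomial Turing kernelization. -/
structure IsPolyTruthTableKernelization (M : OracleTM) (P : ParameterizedProblem) : Prop
    extends M.IsPolyTuringKernelization P where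
  nonAdaptive : M.NonAdaptive

end OracleTM

/-- A Boolean gate of fan-in at most two whose arguments are taken from `m` wires. -/
inductive Gate (m : ℕ) : Type
  | const (b : Bool)
  | not (i : Fin m)
  | and (i j : Fin m)
  | or (i j : Fin m)

/-- The value computed by a gate, given the values of the wires. -/
def Gate.eval {m : ℕ} (v : Fin m → Bool) : Gate m → Bool
  | .const b => b
  | .not i => !(v i)
  | .and i j => v i && v j
  | .or i j => v i || v j

/-- Sequences of `s` gates over `n` inputs. The wires available to a gate are the inputs (numbered
first) and the outputs of all earlier gates. -/
inductive Gates (n : ℕ) : ℕ → Type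
  | nil : Gates n 0
  | snoc {s : ℕ} (gs : Gates n s) (g : Gate (n + s)) : Gates n (s + 1)

/-- The values of all wires (inputs, then gates), given the values of the inputs. -/
def Gates.eval {n : ℕ} (v : Fin n → Bool) : {s : ℕ} → Gates n s → Fin (n + s) → Bool
  | _, .nil => v
  | _, .snoc gs g => Fin.snoc (α := fun _ => Bool) (gs.eval v) (g.eval (gs.eval v))

/-- Boolean circuits with `n` inputs and one output. -/
structure Circuit (n : ℕ) where
  /-- the number of gates -/
  size : ℕ
  /-- the gates -/
  gates : Gates n size
  /-- the wire that carries the output -/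
  out : Fin (n + size)

/-- The output of a circuit. -/
def Circuit.eval {n : ℕ} (C : Circuit n) (v : Fin n → Bool) : Bool :=
  C.gates.eval v C.out

open Classical in
/-- The oracle `O`'s answers to the queries in the list `qs`. -/
noncomputable def answers (O : Set (List Bool)) (qs : List (List Bool)) : Fin qs.length → Bool :=
  fun i => decide (qs.get i ∈ O)

/-- A psize kernelization: a polynomial truth-table kernelization that, on an input `x` with
parameter value `k`, makes at most `poly(k)` queries, and whose output on `x` is that of a circuit
of size `poly(k)` applied to the answers of the oracle, whatever these answers are. -/
structure OracleTM.IsPsizeKernelization (M : OracleTM) (P : ParameterizedProblem) : Prop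
    extends M.IsPolyTruthTableKernelization P where
  psize : ∃ q r : Polynomial ℕ, ∀ x : List Bool, ∃ (qs : List (List Bool)) (C : Circuit qs.length),
    qs.length ≤ q.eval (P.param x) ∧ C.size ≤ r.eval (P.param x) ∧
    ∀ (O : Set (List Bool)) (t : ℕ) (qs' : List (List Bool)) (b : Bool),
      M.Run O x t qs' b → qs' = qs ∧ b = C.eval (answers O qs)

end Kernelization

/-! An instance is a list of blocks, and it is a yes-instance if some nonempty block or its reversal
lies in a language `A`. If ℓ is the length of a longest block, the parameter is k = 2^c with c of
order √ℓ. Hence ℓ is bounded by a polynomial in k (`length_le_blockParam`), while the 2^ℓ strings of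
length ℓ outnumber every polynomial in k (`blockParam_le`, `exists_eval_four_pow_lt`). Using a power
of two makes the binary value of the parameter a string of zeros and a single one, so a machine with
unary counters can produce it.

For every `A`, however complex, asking the oracle about each block as an instance of its own and
taking the disjunction is a polynomial truth-table kernelization
(`blockTM_isPolyTruthTableKernelization`).

For a suitable `A` there is no psize kernelization. Fix a machine `M` and polynomial bounds `q`, `f`
on the number and length of its queries. On the instance containing all strings of length m², the
queries are the same for every oracle, and for large m they contain fewer than 2^(m²) blocks,
counting reversals. So some string y of length m² is missed. Switching `A` at y, with all other
strings of that length excluded, changes the correct answer but not the oracle's answers, which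
determine the output. Hence the languages for which `M` succeeds within these bounds form a nowhere
dense subset of Cantor space (`not_subset_closure_psizeSet`). There are countably many triples (`M`,
`q`, `f`), so the Baire category theorem yields an `A` outside all these sets. -/

namespace Kernelization

/-! ### Encoding of blocks -/

/-- The one-block instance whose block is the given string: data bits are preceded by `true`. -/
def encodeBlock : List Bool → List Bool
  | [] => []
  | c :: b => true :: c :: encodeBlock b

/-- The blocks of a string, each in reversed order. The string is read in pairs: `true, c` is the
data bit `c`, and `false, _` separates blocks. The first argument is the block read so far. -/
def blocksAux : List Bool → List Bool → List (List Bool)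
  | acc, true :: c :: l => blocksAux (c :: acc) l
  | acc, false :: _ :: l => acc :: blocksAux [] l
  | acc, [] => [acc]
  | acc, [_] => [acc]

/-- The blocks of a string, each in reversed order. -/
def blocks (x : List Bool) : List (List Bool) := blocksAux [] x

theorem length_encodeBlock (b : List Bool) : (encodeBlock b).length = 2 * b.length := by
  induction b with
  | nil => rfl
  | cons c b ih => simp [encodeBlock, ih]; ring

theorem blocksAux_encodeBlock_append (b acc l : List Bool) :
    blocksAux acc (encodeBlock b ++ l) = blocksAux (b.reverse ++ acc) l := by
  induction b generalizing acc with
  | nil => rfl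
  | cons c b ih => simp [encodeBlock, blocksAux, ih]

theorem blocks_encodeBlock (b : List Bool) : blocks (encodeBlock b) = [b.reverse] := by
  simpa [blocks, blocksAux] using blocksAux_encodeBlock_append b [] []

theorem length_blocksAux_le (acc l : List Bool) : (blocksAux acc l).length ≤ l.length + 1 := by
  induction acc, l using blocksAux.induct <;> simp_all [blocksAux] <;> omega

theorem length_blocks_le (x : List Bool) : (blocks x).length ≤ x.length + 1 :=
  length_blocksAux_le [] x

/-- The block being read only grows until it is closed. This lets `counter_le` charge the growth of
the counter to a completed block. -/
theorem exists_mem_blocksAux_length_le (acc l : List Bool) :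
    ∃ b ∈ blocksAux acc l, acc.length ≤ b.length := by
  induction acc, l using blocksAux.induct with
  | case1 acc c l ih =>
    obtain ⟨b, hb, h⟩ := ih
    exact ⟨b, hb, by simp at h; omega⟩
  | _ => simp [blocksAux]

/-- The instance with an empty block followed by the blocks in the list. -/
def joinBlocks (bs : List (List Bool)) : List Bool :=
  bs.flatMap fun b => false :: false :: encodeBlock b

theorem blocks_joinBlocks (bs : List (List Bool)) :
    blocks (joinBlocks bs) = [] :: bs.map List.reverse := by
  have key : ∀ acc, blocksAux acc (joinBlocks bs) = acc :: bs.map List.reverse := by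
    induction bs with
    | nil => intro acc; rfl
    | cons b bs ih =>
      intro acc
      have h := ih b.reverse
      simp only [joinBlocks] at h
      simp [joinBlocks, blocksAux, blocksAux_encodeBlock_append, h]
  exact key []

/-! ### The square-root counter and the parameter -/

/-- The final value of a counter which a block of length `ℓ` raises to at least about `√(2ℓ)`.
The counter consists of three parts `a`, `b`, `r`. Every data bit moves one unit from `a` to `b`;
when `a` is exhausted, all of `b` is moved back to `a`, together with one more unit taken from the
reserve `r`, or a new one if `r = 0`. A separator returns everything to the reserve. -/
def counter : ℕ → ℕ → ℕ → List Bool → ℕ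
  | a + 1, b, r, true :: _ :: l => counter a (b + 1) r l
  | 0, b, r, true :: _ :: l => counter (b + 1) 0 (r - 1) l
  | a, b, r, false :: _ :: l => counter 0 0 (r + a + b) l
  | a, b, r, [] => a + b + r
  | a, b, r, [_] => a + b + r

/-- Each move preserves the total, except that a unit is created when the reserve is empty. Started
from zero, the total thus remembers the largest `a + b` over all blocks. -/
theorem le_counter (a b r : ℕ) (l : List Bool) : a + b + r ≤ counter a b r l := by
  induction a, b, r, l using counter.induct <;> simp only [counter] <;> omega

/-- With s = `a + b`, draining `a` takes s bits and the refill that raises s takes one more, so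
s(s+1)/2 + `b` bits have been read in the current block. The hypothesis is a crude upper half of
this invariant. -/
theorem length_le_counter {a b r : ℕ} {l acc : List Bool} (h : acc.length ≤ b + (a + b) ^ 2) :
    ∀ bl ∈ blocksAux acc l, bl.length ≤ counter a b r l + counter a b r l ^ 2 := by
  induction a, b, r, l using counter.induct generalizing acc with
  | case1 a b r c l ih =>
    simp only [counter, blocksAux]
    exact ih (by simp; nlinarith)
  | case2 b r c l ih =>
    simp only [counter, blocksAux]
    exact ih (by simp; nlinarith)
  | case3 a b r c l ih =>
    simp only [counter, blocksAux, List.mem_cons]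
    rintro bl (rfl | hbl)
    · have := le_counter 0 0 (r + a + b) l
      have h2 : a + b ≤ counter 0 0 (r + a + b) l := by omega
      nlinarith
    · exact ih (by simp) bl hbl
  | case4 | case5 =>
    simp only [counter, blocksAux, List.mem_singleton]
    rintro bl rfl
    nlinarith

/-- The hypothesis `hacc` is the lower half of the same invariant. The total rises only when the
reserve is empty; it is then the new `a + b`, whose square is bounded by twice the length of the
current block. -/
theorem counter_le {a b r m : ℕ} {l acc : List Bool}
    (hacc : (a + b) * (a + b + 1) + 2 * b ≤ 2 * acc.length)
    (hl : ∀ bl ∈ blocksAux acc l, bl.length ≤ m ^ 2) (hm : a + b + r ≤ 2 * m) :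
    counter a b r l ≤ 2 * m := by
  induction a, b, r, l using counter.induct generalizing acc with
  | case1 a b r c l ih =>
    simp only [counter, blocksAux] at hl ⊢
    exact ih (by simp; nlinarith) hl (by omega)
  | case2 b r c l ih =>
    simp only [counter, blocksAux] at hl ⊢
    have h1 : (b + 1 + 0) * (b + 1 + 0 + 1) + 2 * 0 ≤ 2 * (c :: acc).length := by
      simp; nlinarith
    refine ih h1 hl ?_
    obtain ⟨bl, hbl, hle⟩ := exists_mem_blocksAux_length_le (c :: acc) l
    have h2 := hl bl hbl
    -- The invariant gives (b + 1)(b + 2) ≤ 2m²; the constant is rounded up so that both sides are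
    -- squares.
    have h3 : (b + 1) ^ 2 ≤ (2 * m) ^ 2 := by nlinarith
    have := (Nat.pow_le_pow_iff_left two_ne_zero).1 h3
    omega
  | case3 a b r c l ih =>
    simp only [counter, blocksAux, List.mem_cons, forall_eq_or_imp] at hl ⊢
    exact ih (by simp) hl.2 (by omega)
  | case4 | case5 => simpa only [counter] using hm

/-- The parameter of an instance. -/
def blockParam (x : List Bool) : ℕ := 2 ^ counter 0 0 0 x

theorem length_le_blockParam {x b : List Bool} (hb : b ∈ blocks x) :
    b.length ≤ blockParam x + blockParam x ^ 2 := by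
  have h : counter 0 0 0 x ≤ blockParam x := Nat.lt_two_pow_self.le
  have := length_le_counter (a := 0) (b := 0) (r := 0) (acc := []) (by simp) b hb
  exact this.trans (Nat.add_le_add h (Nat.pow_le_pow_left h 2))

theorem blockParam_le {x : List Bool} {m : ℕ} (h : ∀ b ∈ blocks x, b.length ≤ m ^ 2) :
    blockParam x ≤ 4 ^ m := by
  have : counter 0 0 0 x ≤ 2 * m := counter_le (acc := []) (by simp) h (by simp)
  calc blockParam x ≤ 2 ^ (2 * m) := Nat.pow_le_pow_right two_pos this
    _ = 4 ^ m := by rw [pow_mul]; norm_num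

end Kernelization

namespace Kernelization

/-! ### Polynomial-time computability of the parameter -/

theorem encodePosNum_two_pow (p : PosNum) (k : ℕ) (h : (p : ℕ) = 2 ^ k) :
    Computability.encodePosNum p = List.replicate k false ++ [true] := by
  induction p generalizing k with
  | one =>
    have h1 : 1 = 2 ^ k := h
    obtain rfl : k = 0 := by rw [eq_comm, Nat.pow_eq_one] at h1; omega
    rfl
  | bit0 p ih =>
    cases k with
    | zero => have := p.cast_pos (α := ℕ); rw [PosNum.cast_bit0] at h; omega
    | succ k =>
      rw [PosNum.cast_bit0, pow_succ] at h
      simp [Computability.encodePosNum, ih k (by omega), List.replicate_succ]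
  | bit1 p ih =>
    have := p.cast_pos (α := ℕ)
    cases k with
    | zero => rw [PosNum.cast_bit1] at h; omega
    | succ k => rw [PosNum.cast_bit1, pow_succ] at h; omega

theorem encodeNat_two_pow (k : ℕ) :
    Computability.encodeNat (2 ^ k) = List.replicate k false ++ [true] := by
  unfold Computability.encodeNat
  have h : (((2 ^ k : ℕ) : Num) : ℕ) = 2 ^ k := Num.to_of_nat _
  cases hn : ((2 ^ k : ℕ) : Num) with
  | zero =>
    rw [hn] at h
    have := Nat.two_pow_pos k
    have h0 : ((Num.zero : Num) : ℕ) = 0 := rfl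
    omega
  | pos p =>
    rw [hn] at h
    exact encodePosNum_two_pow p k h

/-- `ReachesIn f n c c'`: iterating `f` leads from `c` to `c'` in at most `n` steps. -/
def ReachesIn {C : Type*} (f : C → Option C) (n : ℕ) (c c' : C) : Prop :=
  Nonempty (StateTransition.EvalsToInTime f c (some c') n)

namespace ReachesIn

variable {C : Type*} {f : C → Option C} {n m : ℕ} {c c' c'' : C}

theorem trans (h : ReachesIn f n c c') (h' : ReachesIn f m c' c'') :
    ReachesIn f (m + n) c c'' := by
  obtain ⟨h⟩ := h
  obtain ⟨h'⟩ := h'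
  exact ⟨h.trans f n m c c' (some c'') h'⟩

theorem mono (h : ReachesIn f n c c') (hm : n ≤ m) : ReachesIn f m c c' := by
  obtain ⟨h⟩ := h
  exact ⟨⟨h.toEvalsTo, h.steps_le_m.trans hm⟩⟩

theorem single (h : f c = some c') : ReachesIn f 1 c c' :=
  ⟨⟨⟨1, by simpa [flip] using h⟩, le_rfl⟩⟩

theorem head (h : f c = some c') (h' : ReachesIn f n c' c'') : ReachesIn f (n + 1) c c'' :=
  (single h).trans h'

end ReachesIn

open Turing.TM2.Stmt in
/-- The program of `paramTM`. Stack `0` holds the input, stacks `1`, `2`, `3` hold the three parts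
of the counter in unary, and stack `4` is the output. -/
def paramProgram : Fin 5 →
    Turing.TM2.Stmt (fun _ : Fin 5 => Bool) (Fin 5) (Option Bool × Option Bool) :=
  ![push 4 (fun _ => true) <| goto fun _ => 1,
    pop 0 (fun s o => (o, s.2)) <| pop 0 (fun s o => (s.1, o)) <|
      branch (fun s => s.2.isNone) (goto fun _ => 4) <|
      branch (fun s => s.1 = some false) (goto fun _ => 3) <|
      pop 1 (fun s o => (o, s.2)) <|
      branch (fun s => s.1.isSome) (push 2 (fun _ => false) <| goto fun _ => 1) <|
      pop 3 (fun s o => (o, s.2)) <| push 1 (fun _ => false) <|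
      branch (fun s => s.1.isSome) (goto fun _ => 2) (push 4 (fun _ => false) <| goto fun _ => 2),
    pop 2 (fun s o => (o, s.2)) <|
      branch (fun s => s.1.isSome) (push 1 (fun _ => false) <| goto fun _ => 2) <|
      goto fun _ => 1,
    pop 2 (fun s o => (o, s.2)) <|
      branch (fun s => s.1.isSome) (push 3 (fun _ => false) <| goto fun _ => 3) <|
      pop 1 (fun s o => (o, s.2)) <|
      branch (fun s => s.1.isSome) (push 3 (fun _ => false) <| goto fun _ => 3) <|
      goto fun _ => 1,
    pop 1 (fun s o => (o, s.2)) <|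
      branch (fun s => s.1.isSome) (goto fun _ => 4) <|
      pop 2 (fun s o => (o, s.2)) <|
      branch (fun s => s.1.isSome) (goto fun _ => 4) <|
      pop 3 (fun s o => (o, s.2)) <|
      branch (fun s => s.1.isSome) (goto fun _ => 4) <|
      load (fun _ => (none, none)) halt]

/-- A machine that computes `blockParam`. -/
def paramTM : Turing.FinTM2 where
  K := Fin 5
  k₀ := 0
  k₁ := 4
  Γ _ := Bool
  Λ := Fin 5
  main := 0
  σ := Option Bool × Option Bool
  initialState := (none, none)
  Γk₀Fin := inferInstanceAs (Fintype Bool)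
  m := paramProgram

/-- The configurations of `paramTM`. -/
def paramCfg (l : Option (Fin 5)) (s : Option Bool × Option Bool) (inp : List Bool)
    (a b r c : ℕ) : Turing.TM2.Cfg (fun _ : Fin 5 => Bool) (Fin 5) (Option Bool × Option Bool) where
  l := l
  var := s
  stk := ![inp, List.replicate a false, List.replicate b false, List.replicate r false,
    List.replicate c false ++ [true]]

/-- One step of `paramTM`. -/
abbrev paramStep := Turing.TM2.step paramProgram

variable {s : Option Bool × Option Bool} {inp : List Bool} {a b r c : ℕ}

theorem paramStep_eq {i : Fin 5} {l : Option (Fin 5)} {s' : Option Bool × Option Bool}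
    {inp' : List Bool} {a' b' r' c' : ℕ}
    (h : Turing.TM2.stepAux (paramProgram i) s (paramCfg none s inp a b r c).stk =
      paramCfg l s' inp' a' b' r' c') :
    paramStep (paramCfg (some i) s inp a b r c) = some (paramCfg l s' inp' a' b' r' c') :=
  congrArg some h

theorem paramStep_data_succ (d : Bool) :
    paramStep (paramCfg (some 1) s (true :: d :: inp) (a + 1) b r c) =
    some (paramCfg (some 1) (some false, some d) inp a (b + 1) r c) := by
  apply paramStep_eq
  simp [paramProgram, paramCfg, List.replicate_succ]
  ext i : 1
  fin_cases i <;> simp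

theorem paramStep_data_reserve (d : Bool) :
    paramStep (paramCfg (some 1) s (true :: d :: inp) 0 b (r + 1) c) =
    some (paramCfg (some 2) (some false, some d) inp 1 b r c) := by
  apply paramStep_eq
  simp [paramProgram, paramCfg, List.replicate_succ]
  ext i : 1
  fin_cases i <;> simp

theorem paramStep_data_new (d : Bool) :
    paramStep (paramCfg (some 1) s (true :: d :: inp) 0 b 0 c) =
    some (paramCfg (some 2) (none, some d) inp 1 b 0 (c + 1)) := by
  apply paramStep_eq
  simp [paramProgram, paramCfg, List.replicate_succ]
  ext i : 1
  fin_cases i <;> simp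

theorem paramStep_separator (d : Bool) :
    paramStep (paramCfg (some 1) s (false :: d :: inp) a b r c) =
    some (paramCfg (some 3) (some false, some d) inp a b r c) := by
  apply paramStep_eq
  simp [paramProgram, paramCfg]
  ext i : 1
  fin_cases i <;> simp

theorem paramStep_nil : paramStep (paramCfg (some 1) s [] a b r c) =
    some (paramCfg (some 4) (none, none) [] a b r c) := by
  apply paramStep_eq
  simp [paramProgram, paramCfg]

theorem paramStep_singleton (d : Bool) : paramStep (paramCfg (some 1) s [d] a b r c) =
    some (paramCfg (some 4) (some d, none) [] a b r c) := by
  apply paramStep_eq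
  simp [paramProgram, paramCfg]
  ext i : 1
  fin_cases i <;> simp

theorem paramStep_grow_succ : paramStep (paramCfg (some 2) s inp a (b + 1) r c) =
    some (paramCfg (some 2) (some false, s.2) inp (a + 1) b r c) := by
  apply paramStep_eq
  simp [paramProgram, paramCfg, List.replicate_succ]
  ext i : 1
  fin_cases i <;> simp

theorem paramStep_grow_zero : paramStep (paramCfg (some 2) s inp a 0 r c) =
    some (paramCfg (some 1) (none, s.2) inp a 0 r c) := by
  apply paramStep_eq
  simp [paramProgram, paramCfg]

theorem paramStep_reset_right : paramStep (paramCfg (some 3) s inp a (b + 1) r c) =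
    some (paramCfg (some 3) (some false, s.2) inp a b (r + 1) c) := by
  apply paramStep_eq
  simp [paramProgram, paramCfg, List.replicate_succ]
  ext i : 1
  fin_cases i <;> simp

theorem paramStep_reset_left : paramStep (paramCfg (some 3) s inp (a + 1) 0 r c) =
    some (paramCfg (some 3) (some false, s.2) inp a 0 (r + 1) c) := by
  apply paramStep_eq
  simp [paramProgram, paramCfg, List.replicate_succ]
  ext i : 1
  fin_cases i <;> simp

theorem paramStep_reset_zero : paramStep (paramCfg (some 3) s inp 0 0 r c) =
    some (paramCfg (some 1) (none, s.2) inp 0 0 r c) := by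
  apply paramStep_eq
  simp [paramProgram, paramCfg]
  ext i : 1
  fin_cases i <;> simp

theorem paramStep_clear_left : paramStep (paramCfg (some 4) s inp (a + 1) b r c) =
    some (paramCfg (some 4) (some false, s.2) inp a b r c) := by
  apply paramStep_eq
  simp [paramProgram, paramCfg, List.replicate_succ]
  ext i : 1
  fin_cases i <;> simp

theorem paramStep_clear_right : paramStep (paramCfg (some 4) s inp 0 (b + 1) r c) =
    some (paramCfg (some 4) (some false, s.2) inp 0 b r c) := by
  apply paramStep_eq
  simp [paramProgram, paramCfg, List.replicate_succ]
  ext i : 1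
  fin_cases i <;> simp

theorem paramStep_clear_reserve : paramStep (paramCfg (some 4) s inp 0 0 (r + 1) c) =
    some (paramCfg (some 4) (some false, s.2) inp 0 0 r c) := by
  apply paramStep_eq
  simp [paramProgram, paramCfg, List.replicate_succ]
  ext i : 1
  fin_cases i <;> simp

theorem paramStep_halt : paramStep (paramCfg (some 4) s inp 0 0 0 c) =
    some (paramCfg none (none, none) inp 0 0 0 c) := by
  apply paramStep_eq
  simp [paramProgram, paramCfg]
  ext i : 1
  fin_cases i <;> simp

theorem reaches_grow {n : ℕ} (hn : n = a + b) :
    ∃ s', ReachesIn paramStep (b + 1) (paramCfg (some 2) s inp a b r c)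
      (paramCfg (some 1) s' inp n 0 r c) := by
  subst hn
  induction b generalizing s a with
  | zero => exact ⟨_, .single paramStep_grow_zero⟩
  | succ b ih =>
    obtain ⟨s', h⟩ := ih (s := (some false, s.2)) (a := a + 1)
    rw [show a + 1 + b = a + (b + 1) by omega] at h
    exact ⟨s', .head paramStep_grow_succ h⟩

theorem reaches_reset : ∃ s', ReachesIn paramStep (a + b + 1) (paramCfg (some 3) s inp a b r c)
    (paramCfg (some 1) s' inp 0 0 (r + a + b) c) := by
  induction b generalizing s r with
  | zero =>
    induction a generalizing s r with
    | zero => exact ⟨_, .single paramStep_reset_zero⟩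
    | succ a ih =>
      obtain ⟨s', h⟩ := ih (s := (some false, s.2)) (r := r + 1)
      rw [show r + 1 + a + 0 = r + (a + 1) + 0 by omega] at h
      exact ⟨s', (ReachesIn.head paramStep_reset_left h).mono (by omega)⟩
  | succ b ih =>
    obtain ⟨s', h⟩ := ih (s := (some false, s.2)) (r := r + 1)
    rw [show r + 1 + a + b = r + a + (b + 1) by omega] at h
    exact ⟨s', .head paramStep_reset_right h⟩

/-- `Turing.haltList` requires every stack but the output to be empty and the internal state to be
the initial one. -/
theorem reaches_clear : ReachesIn paramStep (a + b + r + 1) (paramCfg (some 4) s inp a b r c)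
    (paramCfg none (none, none) inp 0 0 0 c) := by
  induction a generalizing s with
  | zero =>
    induction b generalizing s with
    | zero =>
      induction r generalizing s with
      | zero => exact .single paramStep_halt
      | succ r ih => exact (ReachesIn.head paramStep_clear_reserve ih).mono (by omega)
    | succ b ih => exact (ReachesIn.head paramStep_clear_right ih).mono (by omega)
  | succ a ih => exact (ReachesIn.head paramStep_clear_left ih).mono (by omega)

/-- The output holds one zero for each unit ever created, so `hc` is preserved. Each pair of symbols
costs at most one transfer of the whole counter, which explains the quadratic bound. -/
theorem reaches_counter (hc : c = a + b + r) :
    ReachesIn paramStep ((inp.length + 1) * (inp.length + c + 3)) (paramCfg (some 1) s inp a b r c)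
      (paramCfg none (none, none) [] 0 0 0 (counter a b r inp)) := by
  induction a, b, r, inp using counter.induct generalizing s c with
  | case1 a b r d l ih =>
    exact (ReachesIn.head (paramStep_data_succ d) (ih (by omega))).mono (by simp; nlinarith)
  | case2 b r d l ih =>
    simp only [counter]
    cases r with
    | zero =>
      obtain ⟨s', h⟩ := reaches_grow (s := (none, some d)) (inp := l) (r := 0) (c := c + 1)
        (add_comm b 1)
      refine ((ReachesIn.head (paramStep_data_new d) h).trans (ih (by omega))).mono ?_
      simp; nlinarith
    | succ r =>
      obtain ⟨s', h⟩ := reaches_grow (s := (some false, some d)) (inp := l) (r := r) (c := c)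
        (add_comm b 1)
      refine ((ReachesIn.head (paramStep_data_reserve d) h).trans (ih (by omega))).mono ?_
      simp; nlinarith
  | case3 a b r d l ih =>
    obtain ⟨s', h⟩ := reaches_reset (s := (some false, some d)) (inp := l) (a := a) (b := b)
      (r := r) (c := c)
    simp only [counter]
    refine ((ReachesIn.head (paramStep_separator d) h).trans (ih (by omega))).mono ?_
    simp; nlinarith
  | case4 a b r =>
    subst hc
    simp only [counter]
    exact (ReachesIn.head paramStep_nil reaches_clear).mono (by simp)
  | case5 a b r d =>
    subst hc
    simp only [counter]
    exact (ReachesIn.head (paramStep_singleton d) reaches_clear).mono (by simp; omega)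

/-- The first step puts the final `true` at the bottom of the output: `encodeNat` lists the least
significant digit first. -/
theorem paramTM_initList (x : List Bool) : paramStep (Turing.initList paramTM x) =
    some (paramCfg (some 1) (none, none) x 0 0 0 0) := by
  simp only [paramStep, Turing.initList, paramCfg, Turing.TM2.step, paramTM, paramProgram]
  simp
  ext i : 1
  fin_cases i <;> simp
  all_goals rfl

theorem paramTM_haltList (c : ℕ) :
    Turing.haltList paramTM (List.replicate c false ++ [true]) =
      paramCfg none (none, none) [] 0 0 0 c := by
  simp only [Turing.haltList, paramCfg, paramTM]
  congr 1
  ext i : 1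
  fin_cases i <;> simp
  all_goals rfl

theorem paramTM_reaches {x y z : List Bool} {n : ℕ} (hy : y = x)
    (hz : z = Computability.encodeNat (blockParam x))
    (hn : (x.length + 1) * (x.length + 3) + 1 ≤ n) :
    ReachesIn paramStep n (Turing.initList paramTM y) (Turing.haltList paramTM z) := by
  subst hy hz
  rw [blockParam, encodeNat_two_pow, paramTM_haltList]
  exact (ReachesIn.head (paramTM_initList y) (reaches_counter rfl)).mono hn

open Polynomial in
/-- The parameter is computable in polynomial time. -/
noncomputable def blockParamComputable :
    Turing.TM2ComputableInPolyTime (id : List Bool → List Bool) Computability.encodeNat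
      blockParam where
  tm := paramTM
  inputAlphabet := Equiv.refl Bool
  outputAlphabet := Equiv.refl Bool
  time := (X + 1) * (X + 3) + 1
  outputsFun x := (paramTM_reaches (List.map_id x) (List.map_id _) (by simp)).some

end Kernelization

namespace Kernelization

/-! ### The block problem and its truth-table kernelization -/

/-- The property of a block that is decided by a language `A`, given as a characteristic
function. It is invariant under reversal of the block. -/
def Marked (A : List Bool → Bool) (b : List Bool) : Prop :=
  b ≠ [] ∧ (A b = true ∨ A b.reverse = true)

/-- Reading a block onto a stack reverses it; by this symmetry the query may be sent without
restoring the order. -/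
theorem marked_reverse {A : List Bool → Bool} {b : List Bool} :
    Marked A b.reverse ↔ Marked A b := by
  simp [Marked, or_comm]

/-- The parameterized problem whose yes-instances are the strings with a marked block. -/
noncomputable def blockProblem (A : List Bool → Bool) : ParameterizedProblem where
  lang := {x | ∃ b ∈ blocks x, Marked A b}
  param := blockParam
  param_polytime := ⟨blockParamComputable⟩

theorem encodeBlock_mem_lang {A : List Bool → Bool} {b : List Bool} :
    encodeBlock b ∈ (blockProblem A).lang ↔ Marked A b := by
  simp [blockProblem, blocks_encodeBlock, marked_reverse]

/-- The internal states of `blockTM`: the last two symbols read, and whether some query has been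
answered positively. -/
abbrev BlockState := Option Bool × Option Bool × Bool

/-- Numbering of the internal states of `blockTM`. -/
noncomputable def stateEquiv : BlockState ≃ Fin (Fintype.card BlockState) :=
  Fintype.equivFin _

/-- The program of `blockTM`. Stack `0` holds the input, and stack `1` the query. -/
noncomputable def blockProgram : Fin 4 →
    Turing.TM2.Stmt (fun _ : Fin 2 => Bool) (Fin 4) (Fin (Fintype.card BlockState)) :=
  open Turing.TM2.Stmt in
  ![pop 0 (fun s o => stateEquiv (o, (stateEquiv.symm s).2)) <|
      pop 0 (fun s o => stateEquiv ((stateEquiv.symm s).1, o, (stateEquiv.symm s).2.2)) <|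
      branch (fun s => (stateEquiv.symm s).1 = some true && (stateEquiv.symm s).2.1.isSome)
        (push 1 (fun s => (stateEquiv.symm s).2.1.getD false) <| push 1 (fun _ => true) <|
          goto fun _ => 0)
        (goto fun _ => 1),
    halt,
    load (fun s => stateEquiv ((stateEquiv.symm s).1, (stateEquiv.symm s).2.1, true)) <|
      branch (fun s => (stateEquiv.symm s).2.1.isNone) halt (goto fun _ => 0),
    branch (fun s => (stateEquiv.symm s).2.1.isNone) halt (goto fun _ => 0)]

/-- The oracle machine that queries every block and accepts if some answer is positive. -/
noncomputable def blockTM : OracleTM where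
  numStacks := 2
  numLabels := 4
  numStates := Fintype.card BlockState
  inputStack := 0
  queryStack := 1
  main := 0
  queryLabel := 1
  yesLabel := 2
  noLabel := 3
  initialState := stateEquiv (none, none, false)
  accept s := (stateEquiv.symm s).2.2
  program := blockProgram

/-- The configurations of `blockTM`. -/
noncomputable def blockCfg (l : Option (Fin 4)) (s : BlockState) (inp qry : List Bool) :
    Turing.TM2.Cfg (fun _ : Fin 2 => Bool) (Fin 4) (Fin (Fintype.card BlockState)) where
  l := l
  var := stateEquiv s
  stk := ![inp, qry]

theorem blockTM_init (x : List Bool) :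
    blockTM.init x = blockCfg (some 0) (none, none, false) x [] := by
  simp only [OracleTM.init, blockCfg, blockTM]
  congr 1
  ext i : 1
  fin_cases i <;> rfl

/-- One step of `blockTM`. -/
noncomputable abbrev blockStep := Turing.TM2.step blockProgram

variable {s : BlockState} {inp qry : List Bool}

theorem blockStep_eq {i l : _} {s' : BlockState} {inp' qry' : List Bool}
    (h : Turing.TM2.stepAux (blockProgram i) (stateEquiv s) (blockCfg none s inp qry).stk =
      blockCfg l s' inp' qry') :
    blockStep (blockCfg (some i) s inp qry) =
      some (blockCfg l s' inp' qry') :=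
  congrArg some h

theorem blockStep_data (d : Bool) :
    blockStep (blockCfg (some 0) s (true :: d :: inp) qry) =
      some (blockCfg (some 0) (some true, some d, s.2.2) inp (true :: d :: qry)) := by
  apply blockStep_eq
  simp [blockProgram, blockCfg]
  ext i : 1
  fin_cases i <;> simp

theorem blockStep_separator (d : Bool) :
    blockStep (blockCfg (some 0) s (false :: d :: inp) qry) =
      some (blockCfg (some 1) (some false, some d, s.2.2) inp qry) := by
  apply blockStep_eq
  simp [blockProgram, blockCfg]
  ext i : 1
  fin_cases i <;> simp

theorem blockStep_nil :
    blockStep (blockCfg (some 0) s [] qry) =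
      some (blockCfg (some 1) (none, none, s.2.2) [] qry) := by
  apply blockStep_eq
  simp [blockProgram, blockCfg]

theorem blockStep_singleton (d : Bool) :
    blockStep (blockCfg (some 0) s [d] qry) =
      some (blockCfg (some 1) (some d, none, s.2.2) [] qry) := by
  apply blockStep_eq
  simp [blockProgram, blockCfg]
  ext i : 1
  fin_cases i <;> simp

theorem blockStep_yes_continue (e : Option Bool) (d ans : Bool) :
    blockStep (blockCfg (some 2) (e, some d, ans) inp qry) =
      some (blockCfg (some 0) (e, some d, true) inp qry) := by
  apply blockStep_eq
  simp [blockProgram, blockCfg]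

theorem blockStep_yes_halt (e : Option Bool) (ans : Bool) :
    blockStep (blockCfg (some 2) (e, none, ans) inp qry) =
      some (blockCfg none (e, none, true) inp qry) := by
  apply blockStep_eq
  simp [blockProgram, blockCfg]

theorem blockStep_no_continue (e : Option Bool) (d ans : Bool) :
    blockStep (blockCfg (some 3) (e, some d, ans) inp qry) =
      some (blockCfg (some 0) (e, some d, ans) inp qry) := by
  apply blockStep_eq
  simp [blockProgram, blockCfg]

theorem blockStep_no_halt (e : Option Bool) (ans : Bool) :
    blockStep (blockCfg (some 3) (e, none, ans) inp qry) =
      some (blockCfg none (e, none, ans) inp qry) := by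
  apply blockStep_eq
  simp [blockProgram, blockCfg]

open Classical in
theorem blockTM_afterQuery (O : Set (List Bool)) (l : Option (Fin 4)) :
    blockTM.afterQuery O (blockCfg l s inp qry) =
      blockCfg (some (if qry ∈ O then 2 else 3)) s inp [] := by
  simp only [OracleTM.afterQuery, blockCfg, blockTM]
  congr 1
  ext i : 1
  fin_cases i <;> rfl

variable {O : Set (List Bool)} {t : ℕ} {qs : List (List Bool)} {ans b : Bool}

theorem blockTM_runFrom_step {i : Fin 4} {l : Option (Fin 4)} {s' : BlockState}
    {inp' qry' : List Bool} (hi : i ≠ 1)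
    (h : blockStep (blockCfg (some i) s inp qry) =
      some (blockCfg l s' inp' qry'))
    (h' : blockTM.RunFrom O (blockCfg l s' inp' qry') t qs b) :
    blockTM.RunFrom O (blockCfg (some i) s inp qry) (t + 1) qs b :=
  .step (fun e => hi (Option.some.inj e)) h h'

open Classical in
theorem blockTM_runFrom_query
    (h : blockTM.RunFrom O (blockCfg (some (if qry ∈ O then 2 else 3)) s inp []) t qs b) :
    blockTM.RunFrom O (blockCfg (some 1) s inp qry) (t + 1) (qry :: qs) b := by
  rw [← blockTM_afterQuery O (some 1)] at h
  exact OracleTM.RunFrom.query (M := blockTM) (c := blockCfg (some 1) s inp qry) rfl h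

open Classical in
theorem blockTM_finalQuery (e : Option Bool) :
    blockTM.RunFrom O (blockCfg (some 1) (e, none, ans) inp qry) 2 [qry]
      (ans || decide (qry ∈ O)) := by
  have halt (v : Bool) : blockTM.RunFrom O (blockCfg none (e, none, v) inp []) 0 [] v := by
    have := OracleTM.RunFrom.halt (M := blockTM) (O := O)
      (c := blockCfg none (e, none, v) inp []) rfl
    simpa [blockTM, blockCfg] using this
  apply blockTM_runFrom_query
  by_cases h : qry ∈ O
  · simpa [h] using blockTM_runFrom_step (by decide) (blockStep_yes_halt e ans) (halt true)
  · simpa [h] using blockTM_runFrom_step (by decide) (blockStep_no_halt e ans) (halt ans)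

open Classical in
theorem blockTM_continueQuery (e : Option Bool) (d : Bool)
    (h : blockTM.RunFrom O (blockCfg (some 0) (e, some d, ans || decide (qry ∈ O)) inp []) t qs
      b) :
    blockTM.RunFrom O (blockCfg (some 1) (e, some d, ans) inp qry) (t + 2) (qry :: qs) b := by
  apply blockTM_runFrom_query
  by_cases hq : qry ∈ O
  · simp only [hq, decide_true, Bool.or_true, if_true] at h ⊢
    exact blockTM_runFrom_step (by decide) (blockStep_yes_continue e d ans) h
  · simp only [hq, decide_false, Bool.or_false, if_false] at h ⊢
    exact blockTM_runFrom_step (by decide) (blockStep_no_continue e d ans) h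

-- Pushing a data bit and then `true` keeps the query stack equal to the encoding of the block read
-- so far. A missing second symbol marks the end of the input, so a dangling last symbol just closes
-- the last block.
open Classical in
theorem blockTM_runFrom (O : Set (List Bool)) (acc inp : List Bool) (s : BlockState) :
    ∃ t ≤ 3 * inp.length + 3,
      blockTM.RunFrom O (blockCfg (some 0) s inp (encodeBlock acc)) t
        ((blocksAux acc inp).map encodeBlock)
        (s.2.2 || decide (∃ b ∈ blocksAux acc inp, encodeBlock b ∈ O)) := by
  induction acc, inp using blocksAux.induct generalizing s with
  | case1 acc c l ih =>
    obtain ⟨t, ht, h⟩ := ih (some true, some c, s.2.2)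
    exact ⟨t + 1, by simp; omega, blockTM_runFrom_step (by decide) (blockStep_data c) h⟩
  | case2 acc c l ih =>
    obtain ⟨t, ht, h⟩ := ih (some false, some c, s.2.2 || decide (encodeBlock acc ∈ O))
    refine ⟨t + 2 + 1, by simp; omega,
      blockTM_runFrom_step (by decide) (blockStep_separator c) ?_⟩
    have := blockTM_continueQuery (some false) c h
    simpa [blocksAux, Bool.or_assoc] using this
  | case3 acc =>
    refine ⟨2 + 1, by simp, blockTM_runFrom_step (by decide) blockStep_nil ?_⟩
    simpa [blocksAux] using blockTM_finalQuery none
  | case4 acc c =>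
    refine ⟨2 + 1, by simp, blockTM_runFrom_step (by decide) (blockStep_singleton c) ?_⟩
    simpa [blocksAux] using blockTM_finalQuery (some c)

open Classical in
theorem blockTM_run (O : Set (List Bool)) (x : List Bool) :
    ∃ t ≤ 3 * x.length + 3, blockTM.Run O x t ((blocks x).map encodeBlock)
      (decide (∃ b ∈ blocks x, encodeBlock b ∈ O)) := by
  unfold OracleTM.Run
  rw [blockTM_init]
  obtain ⟨t, ht, h⟩ := blockTM_runFrom O [] x (none, none, false)
  refine ⟨t, ht, ?_⟩
  rw [Bool.false_or] at h
  exact h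

theorem OracleTM.step_ne_some {M : OracleTM} {c c' : M.Cfg} (h : c.l = none) :
    Turing.TM2.step M.program c ≠ some c' := by
  obtain ⟨l, v, S⟩ := c
  obtain rfl : l = none := h
  simp

/-- Determinism makes the explicit run of `blockTM_run` speak for every run. -/
theorem OracleTM.RunFrom.unique {M : OracleTM} {c : M.Cfg} {t t' : ℕ} {qs qs' : List (List Bool)}
    {b b' : Bool} (h : M.RunFrom O c t qs b) (h' : M.RunFrom O c t' qs' b') :
    qs = qs' ∧ b = b' := by
  induction h generalizing t' qs' b' with
  | halt hc =>
    cases h' with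
    | halt => exact ⟨rfl, rfl⟩
    | query hc' => simp [hc] at hc'
    | step _ hs => exact absurd hs (OracleTM.step_ne_some hc)
  | query hc _ ih =>
    cases h' with
    | halt hc' => simp [hc] at hc'
    | query _ hr =>
      obtain ⟨rfl, rfl⟩ := ih hr
      exact ⟨rfl, rfl⟩
    | step hc' => exact absurd hc hc'
  | step hc hs _ ih =>
    cases h' with
    | halt hc' => exact absurd hs (OracleTM.step_ne_some hc')
    | query hc' => exact absurd hc' hc
    | step _ hs' hr =>
      obtain rfl := Option.some.inj (hs.symm.trans hs')
      exact ih hr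

open Polynomial in
theorem blockTM_isPolyTruthTableKernelization (A : List Bool → Bool) :
    blockTM.IsPolyTruthTableKernelization (blockProblem A) where
  polyTime := by
    classical
    refine ⟨3 * X + 3, fun O x => ?_⟩
    obtain ⟨t, ht, h⟩ := blockTM_run O x
    exact ⟨t, _, _, h, by simpa using ht⟩
  decides x t qs b h := by
    classical
    obtain ⟨_, _, h'⟩ := blockTM_run (blockProblem A).lang x
    rw [(h.unique h').2]
    simp only [encodeBlock_mem_lang, decide_eq_true_eq]
    rfl
  query_size := by
    classical
    refine ⟨2 * (X + X ^ 2), fun x t qs b h q hq => ?_⟩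
    obtain ⟨_, _, h'⟩ := blockTM_run (blockProblem A).lang x
    rw [(h.unique h').1] at hq
    obtain ⟨bl, hbl, rfl⟩ := List.mem_map.1 hq
    simpa [length_encodeBlock, blockProblem] using length_le_blockParam hbl
  nonAdaptive x O O' t t' qs qs' b b' h h' := by
    classical
    obtain ⟨_, _, h₁⟩ := blockTM_run O x
    obtain ⟨_, _, h₂⟩ := blockTM_run O' x
    rw [(h.unique h₁).1, (h'.unique h₂).1]

end Kernelization

namespace Kernelization

/-! ### Countability of machines and polynomials -/

section Countability

variable {k l n : ℕ}

/-- Statements contain functions, but only between finite types, so these can be numbered; a Gödel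
numbering with one tag per constructor does the rest. -/
theorem exists_injective_stmt_nat :
    ∃ f : Turing.TM2.Stmt (fun _ : Fin k => Bool) (Fin l) (Fin n) → ℕ, Function.Injective f := by
  obtain ⟨push, hpush⟩ := Countable.exists_injective_nat (Fin k × (Fin n → Bool))
  obtain ⟨pop, hpop⟩ := Countable.exists_injective_nat (Fin k × (Fin n → Option Bool → Fin n))
  obtain ⟨load, hload⟩ := Countable.exists_injective_nat (Fin n → Fin n)
  obtain ⟨branch, hbranch⟩ := Countable.exists_injective_nat (Fin n → Bool)
  obtain ⟨goto, hgoto⟩ := Countable.exists_injective_nat (Fin n → Fin l)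
  let f : Turing.TM2.Stmt (fun _ : Fin k => Bool) (Fin l) (Fin n) → ℕ := fun q =>
    Turing.TM2.Stmt.rec (motive := fun _ => ℕ)
      (fun i g _ c => Nat.pair 0 (Nat.pair (push (i, g)) c))
      (fun i g _ c => Nat.pair 1 (Nat.pair (pop (i, g)) c))
      (fun i g _ c => Nat.pair 2 (Nat.pair (pop (i, g)) c))
      (fun g _ c => Nat.pair 3 (Nat.pair (load g) c))
      (fun g _ _ c d => Nat.pair 4 (Nat.pair (branch g) (Nat.pair c d)))
      (fun g => Nat.pair 5 (goto g))
      (Nat.pair 6 0) q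
  refine ⟨f, fun q => ?_⟩
  induction q with
  | push i g q ih =>
    rintro (_ | _ | _ | _ | _ | _ | _) h <;> simp only [f, Nat.pair_eq_pair] at h <;>
      try omega
    obtain ⟨-, h1, h2⟩ := h
    have := hpush h1
    simp only [Prod.mk.injEq] at this
    rw [this.1, this.2, ih h2]
  | peek i g q ih =>
    rintro (_ | _ | _ | _ | _ | _ | _) h <;> simp only [f, Nat.pair_eq_pair] at h <;>
      try omega
    obtain ⟨-, h1, h2⟩ := h
    have := hpop h1
    simp only [Prod.mk.injEq] at this
    rw [this.1, this.2, ih h2]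
  | pop i g q ih =>
    rintro (_ | _ | _ | _ | _ | _ | _) h <;> simp only [f, Nat.pair_eq_pair] at h <;>
      try omega
    obtain ⟨-, h1, h2⟩ := h
    have := hpop h1
    simp only [Prod.mk.injEq] at this
    rw [this.1, this.2, ih h2]
  | load g q ih =>
    rintro (_ | _ | _ | _ | _ | _ | _) h <;> simp only [f, Nat.pair_eq_pair] at h <;>
      try omega
    rw [hload h.2.1, ih h.2.2]
  | branch g q₁ q₂ ih₁ ih₂ =>
    rintro (_ | _ | _ | _ | _ | _ | _) h <;> simp only [f, Nat.pair_eq_pair] at h <;>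
      try omega
    rw [hbranch h.2.1, ih₁ h.2.2.1, ih₂ h.2.2.2]
  | goto g =>
    rintro (_ | _ | _ | _ | _ | _ | _) h <;> simp only [f, Nat.pair_eq_pair] at h <;>
      try omega
    rw [hgoto h.2]
  | halt =>
    rintro (_ | _ | _ | _ | _ | _ | _) h <;> simp only [f, Nat.pair_eq_pair] at h <;>
      first | rfl | omega

instance : Countable (Turing.TM2.Stmt (fun _ : Fin k => Bool) (Fin l) (Fin n)) :=
  let ⟨_, hf⟩ := exists_injective_stmt_nat
  hf.countable

end Countability

instance : Countable OracleTM := by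
  let f : OracleTM → Σ p : ℕ × ℕ × ℕ, (Fin p.1 × Fin p.1) ×
      (Fin p.2.1 × Fin p.2.1 × Fin p.2.1 × Fin p.2.1) × (Fin p.2.2 × (Fin p.2.2 → Bool)) ×
      (Fin p.2.1 → Turing.TM2.Stmt (fun _ : Fin p.1 => Bool) (Fin p.2.1) (Fin p.2.2)) := fun M =>
    ⟨(M.numStacks, M.numLabels, M.numStates), (M.inputStack, M.queryStack),
      (M.main, M.queryLabel, M.yesLabel, M.noLabel), (M.initialState, M.accept), M.program⟩
  refine Function.Injective.countable (f := f) ?_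
  rintro ⟨k, l, n, a, b, c, d, e, g, h, i, j⟩ ⟨k', l', n', a', b', c', d', e', g', h', i', j'⟩ H
  simp only [f, Sigma.mk.injEq, Prod.mk.injEq] at H
  obtain ⟨⟨rfl, rfl, rfl⟩, H⟩ := H
  simp only [heq_eq_eq, Prod.mk.injEq] at H
  obtain ⟨⟨rfl, rfl⟩, ⟨rfl, rfl, rfl, rfl⟩, ⟨rfl, rfl⟩, rfl⟩ := H
  rfl

instance : Countable (Polynomial ℕ) :=
  (AddMonoidAlgebra.coeff_injective.comp (Polynomial.toFinsuppIso ℕ).injective).countable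

/-! ### Growth of polynomials -/

theorem eval_le_eval {p : Polynomial ℕ} {m n : ℕ} (h : m ≤ n) : p.eval m ≤ p.eval n := by
  rw [Polynomial.eval_eq_sum, Polynomial.eval_eq_sum]
  exact Finset.sum_le_sum fun i _ => Nat.mul_le_mul_left _ (Nat.pow_le_pow_left h i)

theorem eval_le_eval_one_mul_pow (p : Polynomial ℕ) {n : ℕ} (hn : 1 ≤ n) :
    p.eval n ≤ p.eval 1 * n ^ p.natDegree := by
  rw [Polynomial.eval_eq_sum, Polynomial.eval_eq_sum, Polynomial.sum_def, Polynomial.sum_def,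
    Finset.sum_mul]
  refine Finset.sum_le_sum fun i hi => ?_
  rw [one_pow, mul_one]
  exact Nat.mul_le_mul_left _ (Nat.pow_le_pow_right hn (Polynomial.le_natDegree_of_mem_supp i hi))

/-- With d the degree, p(4^m) < 2^(p(1) + 2dm), and m² exceeds this exponent once m ≥ p(1) + 2d + 1.
-/
theorem exists_eval_four_pow_lt (p : Polynomial ℕ) (n : ℕ) :
    ∃ m > n, p.eval (4 ^ m) < 2 ^ m ^ 2 := by
  refine ⟨p.eval 1 + 2 * p.natDegree + n + 1, by omega, ?_⟩
  set m := p.eval 1 + 2 * p.natDegree + n + 1 with hm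
  calc p.eval (4 ^ m) ≤ p.eval 1 * (4 ^ m) ^ p.natDegree :=
        eval_le_eval_one_mul_pow p (Nat.one_le_pow _ _ (by norm_num))
    _ < 2 ^ p.eval 1 * (4 ^ m) ^ p.natDegree :=
        Nat.mul_lt_mul_of_pos_right Nat.lt_two_pow_self (by positivity)
    _ = 2 ^ (p.eval 1 + 2 * m * p.natDegree) := by
        rw [show (4 : ℕ) = 2 ^ 2 by norm_num, ← pow_mul, ← pow_mul, ← pow_add, mul_assoc]
    _ ≤ 2 ^ m ^ 2 := Nat.pow_le_pow_right two_pos (by nlinarith)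

/-! ### The category argument -/

/-- All strings of a given length. -/
def stringsOfLength (n : ℕ) : Finset (List Bool) :=
  (Finset.univ : Finset (List.Vector Bool n)).map
    ⟨List.Vector.toList, List.Vector.toList_injective⟩

theorem mem_stringsOfLength {n : ℕ} {b : List Bool} : b ∈ stringsOfLength n ↔ b.length = n := by
  simp only [stringsOfLength, Finset.mem_map, Finset.mem_univ, true_and]
  exact ⟨fun ⟨v, hv⟩ => hv ▸ v.toList_length, fun h => ⟨⟨b, h⟩, rfl⟩⟩

theorem card_stringsOfLength (n : ℕ) : (stringsOfLength n).card = 2 ^ n := by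
  simp [stringsOfLength]

/-- The blocks on which membership of the given strings in a block problem depends. -/
def relevantBlocks (qs : List (List Bool)) : Finset (List Bool) :=
  let B := (qs.flatMap blocks).toFinset
  B ∪ B.image List.reverse

/-- Each query has at most `n + 1` blocks, and adding the reversals at most doubles the count. -/
theorem card_relevantBlocks_le {qs : List (List Bool)} {n : ℕ} (h : ∀ q ∈ qs, q.length ≤ n) :
    (relevantBlocks qs).card ≤ 2 * (qs.length * (n + 1)) := by
  have h1 : (qs.flatMap blocks).length ≤ qs.length * (n + 1) := by
    rw [List.length_flatMap, ← smul_eq_mul, ← List.length_map (f := fun q => (blocks q).length)]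
    refine List.sum_le_card_nsmul _ _ fun k hk => ?_
    obtain ⟨q, hq, rfl⟩ := List.mem_map.1 hk
    exact (length_blocks_le q).trans (Nat.succ_le_succ (h q hq))
  have h2 := (List.toFinset_card_le (qs.flatMap blocks)).trans h1
  have h3 := Finset.card_union_le (qs.flatMap blocks).toFinset
    ((qs.flatMap blocks).toFinset.image List.reverse)
  have h4 := Finset.card_image_le (s := (qs.flatMap blocks).toFinset) (f := List.reverse)
  simp only [relevantBlocks]
  omega

theorem answers_congr {A A' : List Bool → Bool} {qs : List (List Bool)}
    (h : ∀ b ∈ relevantBlocks qs, A b = A' b) :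
    answers (blockProblem A).lang qs = answers (blockProblem A').lang qs := by
  ext i
  simp only [answers]
  congr 1
  refine propext (exists_congr fun b => and_congr_right fun hb => ?_)
  have hm : b ∈ (qs.flatMap blocks).toFinset :=
    List.mem_toFinset.2 (List.mem_flatMap.2 ⟨_, List.get_mem qs i, hb⟩)
  rw [Marked, Marked, h b (Finset.mem_union_left _ hm),
    h b.reverse (Finset.mem_union_right _ (Finset.mem_image_of_mem _ hm))]

/-- The characteristic functions `A` for which `M` is a psize kernelization of the block problem
of `A` with the given bounds on the number and the length of the queries. -/
def psizeSet (M : OracleTM) (q f : Polynomial ℕ) : Set (List Bool → Bool) :=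
  {A | M.IsPsizeKernelization (blockProblem A) ∧
    (∀ x, ∃ (qs : List (List Bool)) (C : Circuit qs.length), qs.length ≤ q.eval (blockParam x) ∧
      ∀ (O : Set (List Bool)) (t : ℕ) (qs' : List (List Bool)) (b : Bool),
        M.Run O x t qs' b → qs' = qs ∧ b = C.eval (answers O qs)) ∧
    ∀ (x : List Bool) (t : ℕ) (qs : List (List Bool)) (b : Bool),
      M.Run (blockProblem A).lang x t qs b → ∀ u ∈ qs, u.length ≤ f.eval (blockParam x)}

/-- The instance whose nonempty blocks are all strings of length `n`. -/
noncomputable def fullInstance (n : ℕ) : List Bool :=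
  joinBlocks (stringsOfLength n).toList

theorem mem_blocks_fullInstance {n : ℕ} {b : List Bool} :
    b ∈ blocks (fullInstance n) ↔ b = [] ∨ b.length = n := by
  rw [fullInstance, blocks_joinBlocks, List.mem_cons, List.mem_map]
  refine or_congr_right ⟨?_, fun h => ⟨b.reverse, ?_, List.reverse_reverse b⟩⟩
  · rintro ⟨c, hc, rfl⟩
    rwa [List.length_reverse, ← mem_stringsOfLength, ← Finset.mem_toList]
  · rwa [Finset.mem_toList, mem_stringsOfLength, List.length_reverse]

/-- If the set were dense in `U`, two of its members could be found that give the same oracle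
answers on one input but different correct outputs. -/
theorem not_subset_closure_psizeSet (M : OracleTM) (q f : Polynomial ℕ)
    {U : Set (List Bool → Bool)} (hU : IsOpen U) (hne : U.Nonempty)
    (hsub : U ⊆ closure (psizeSet M q f)) : False := by
  classical
  obtain ⟨A₀, hA₀⟩ := hne
  obtain ⟨A, hAU, hA⟩ := mem_closure_iff.1 (hsub hA₀) U hU hA₀
  obtain ⟨F, u, hu, hFU⟩ := isOpen_pi_iff.1 hU A hAU
  -- The polynomial is the bound of `card_relevantBlocks_le` for `q` queries of length `f`. Taking
  -- `m` beyond all lengths in `F` leaves the strings of length `m ^ 2` free to be changed within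
  -- `U`.
  obtain ⟨m, hm, hlt⟩ := exists_eval_four_pow_lt (2 * (q * (f + 1))) (F.sup List.length)
  have hFm : ∀ b ∈ F, b.length ≠ m ^ 2 := fun b hb => by
    have := Finset.le_sup (f := List.length) hb
    nlinarith
  set x := fullInstance (m ^ 2) with hx
  have hκ : blockParam x ≤ 4 ^ m := blockParam_le fun b hb => by
    rcases mem_blocks_fullInstance.1 hb with rfl | h
    · simp
    · exact h.le
  obtain ⟨qs, C, hlen, hC⟩ := hA.2.1 x
  obtain ⟨p, hp⟩ := hA.1.polyTime
  -- The length bound is available for runs with the language of `A` as oracle; `hC` identifies the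
  -- queries of such a run with `qs`.
  have hqs : ∀ v ∈ qs, v.length ≤ f.eval (4 ^ m) := by
    obtain ⟨t, qs', b, hr, -⟩ := hp (blockProblem A).lang x
    obtain ⟨rfl, -⟩ := hC _ _ _ _ hr
    exact fun v hv => (hA.2.2 x t _ b hr v hv).trans (eval_le_eval hκ)
  have hcard : (relevantBlocks qs).card < (stringsOfLength (m ^ 2)).card := by
    rw [card_stringsOfLength]
    refine lt_of_le_of_lt ?_ hlt
    refine (card_relevantBlocks_le hqs).trans ?_
    simp only [Polynomial.eval_mul, Polynomial.eval_add, Polynomial.eval_one,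
      Polynomial.eval_ofNat]
    gcongr
    exact hlen.trans (eval_le_eval hκ)
  obtain ⟨y, hy, hyD⟩ := Finset.exists_mem_notMem_of_card_lt_card hcard
  rw [mem_stringsOfLength] at hy
  let B (v : Bool) (b : List Bool) : Bool :=
    if b = y then v else if b.length = m ^ 2 then false else A b
  let G := F ∪ relevantBlocks qs ∪ stringsOfLength (m ^ 2)
  -- The function `B v` lies in `U` but perhaps not in the set itself. Density supplies a member
  -- agreeing with it on the finite set `G`, which contains everything that the instance and the
  -- queries depend on.
  have approx (v : Bool) : ∃ A' ∈ psizeSet M q f, ∀ b ∈ G, A' b = B v b := by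
    let V : Set (List Bool → Bool) := (G : Set (List Bool)).pi fun b => {B v b}
    have hV : IsOpen V := isOpen_set_pi G.finite_toSet fun _ _ => isOpen_discrete _
    have hBU : B v ∈ U := hFU fun b hb => by
      have h1 := hFm b hb
      have h2 : b ≠ y := fun e => h1 (e ▸ hy)
      simpa only [B, if_neg h1, if_neg h2] using (hu b hb).2
    obtain ⟨A', ⟨-, hA'V⟩, hA'⟩ := mem_closure_iff.1 (hsub hBU) (U ∩ V) (hU.inter hV)
      ⟨hBU, fun _ _ => rfl⟩
    exact ⟨A', hA', fun b hb => hA'V b hb⟩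
  obtain ⟨A₁, hA₁, hB₁⟩ := approx false
  obtain ⟨A₂, hA₂, hB₂⟩ := approx true
  have hans : answers (blockProblem A₁).lang qs = answers (blockProblem A₂).lang qs := by
    refine answers_congr fun b hb => ?_
    have hbG : b ∈ G := Finset.mem_union_left _ (Finset.mem_union_right _ hb)
    have hby : b ≠ y := fun e => hyD (e ▸ hb)
    rw [hB₁ b hbG, hB₂ b hbG]
    simp only [B, if_neg hby]
  obtain ⟨t₁, qs₁, b₁, hr₁, -⟩ := hp (blockProblem A₁).lang x
  obtain ⟨t₂, qs₂, b₂, hr₂, -⟩ := hp (blockProblem A₂).lang x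
  have hb : b₁ = b₂ := by
    rw [(hC _ _ _ _ hr₁).2, (hC _ _ _ _ hr₂).2, hans]
  have hG (b : List Bool) (h : b.length = m ^ 2) : b ∈ G :=
    Finset.mem_union_right _ (mem_stringsOfLength.2 h)
  have hzero (b : List Bool) (h : b.length = m ^ 2) : A₁ b = false := by
    simp [hB₁ b (hG b h), B, h]
  have h₁ : x ∉ (blockProblem A₁).lang := by
    rintro ⟨b, hb, hne, h⟩
    -- The instance starts with a separator and so has an empty block; this is why marked blocks
    -- must be nonempty.
    rcases mem_blocks_fullInstance.1 hb with rfl | hl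
    · exact hne rfl
    · rw [hzero b hl, hzero b.reverse (by simpa using hl)] at h
      simp at h
  have h₂ : x ∈ (blockProblem A₂).lang := by
    refine ⟨y, mem_blocks_fullInstance.2 (Or.inr hy), ?_, Or.inl ?_⟩
    · rintro rfl
      have : 0 < m ^ 2 := Nat.pow_pos (by omega)
      simp at hy
      omega
    · simp [hB₂ y (hG y hy), B]
  rw [← hA₁.1.decides x t₁ qs₁ b₁ hr₁, hb, hA₂.1.decides x t₂ qs₂ b₂ hr₂] at h₁
  exact h₁ h₂

theorem exists_no_psizeKernelization :
    ∃ A : List Bool → Bool, ¬ ∃ M : OracleTM, M.IsPsizeKernelization (blockProblem A) := by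
  by_contra! h
  have hcover : ⋃ i : OracleTM × Polynomial ℕ × Polynomial ℕ,
      closure (psizeSet i.1 i.2.1 i.2.2) = Set.univ := by
    refine Set.eq_univ_of_forall fun A => Set.mem_iUnion.2 ?_
    obtain ⟨M, hM⟩ := h A
    obtain ⟨q, r, hq⟩ := hM.psize
    obtain ⟨f, hf⟩ := hM.query_size
    refine ⟨(M, q, f), subset_closure ⟨hM, fun x => ?_, hf⟩⟩
    obtain ⟨qs, C, h1, -, h2⟩ := hq x
    exact ⟨qs, C, h1, h2⟩
  -- Baire category theorem in the Cantor space `List Bool → Bool`; the index type is countable.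
  obtain ⟨i, hi⟩ := nonempty_interior_of_iUnion_of_closed (fun _ => isClosed_closure) hcover
  exact not_subset_closure_psizeSet _ _ _ isOpen_interior hi interior_subset

end Kernelization

theorem theorem2 :
    ∃ P : Kernelization.ParameterizedProblem,
      (∃ M : Kernelization.OracleTM, M.IsPolyTruthTableKernelization P) ∧
      ¬ ∃ M : Kernelization.OracleTM, M.IsPsizeKernelization P := by
  obtain ⟨A, hA⟩ := Kernelization.exists_no_psizeKernelization
  exact ⟨_, ⟨_, Kernelization.blockTM_isPolyTruthTableKernelization A⟩, hA⟩
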